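/- Let $p$ be a prime with $p\equiv 3 \pmod 4$, let $n$ be an odd positive integer, let $k$ be a positive divisor of $n$, and put $$d=\frac{p^n+1}{p^k+1}+\frac{p^n-1}{2}.$$ Let $f(x)=x^d$ on the finite field $\mathbb{F}_{p^n}$ with $p^n$ elements. For $b\in\mathbb{F}_{p^n}$ let $N(1,b)$ be the number of $x\in\mathbb{F}_{p^n}$ with $f(x+1)-f(x)=b$, and for $i\ge 0$ let $\omega_i$ be the number of $b\in\mathbb{F}_{p^n}$ with $N(1,b)=i$ (the differential spectrum of $f$). If $p^k\neq 3$, then $$\omega_i=\begin{cases}2, & i=\frac{p^k+1}{4},\\[2pt] \frac{p^n-p^k}{p^k-1}, & i=\frac{p^k+1}{2},\\[2pt] \frac{p^n-1}{2}-\frac{p^n-p^k}{p^k-1}, & i=1,\\[2pt] \frac{p^n-3}{2}, & i=0,\\[2pt] 0, & \text{otherwise,}\end{cases}$$ and the two elements $b$ with $N(1,b)=\frac{p^k+1}{4}$ are $b=\pm1$. If $p^k=3$ (so that $\frac{p^k+1}{4}=1$ and the first and third lines above concern the same index, and their values add up), then $\omega_0=\omega_2=\frac{3^n-3}{2}$,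 $\omega_1=3$, and $\omega_i=0$ for all other $i$; the three elements $b$ with $N(1,b)=1$ are $b=0,\pm1$. -/

import Mathlib

/-- `diffCount f a b` is the number `N(a, b)` of solutions `x` of `f (x + a) - f x = b`. -/
noncomputable def diffCount {F : Type*} [Field F] (f : F → F) (a b : F) : ℕ :=
  Set.ncard {x : F | f (x + a) - f x = b}

/-- `diffSpectrum f i` is the entry `ω_i` of the differential spectrum of `f`:
the number of `b` such that `N(1, b) = i`. -/
noncomputable def diffSpectrum {F : Type*} [Field F] (f : F → F) (i : ℕ) : ℕ :=
  Set.ncard {b : F | diffCount f 1 b = i}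

open Finset

/-! Put `q = p ^ k` and `Q = p ^ n`. As `n / k` is odd, `(q + 1) * d ≡ 2` modulo `Q - 1`, `d` is
even, and the `(q + 1)`-st powers are exactly the squares. So `f` is even with `f (u ^ (q + 1)) = u
^ 2`; with `-1` a nonsquare and additivity of `x ↦ x ^ q`, nothing more about `d` is needed.

Sort the solutions `x` by the characters of `x` and `x + 1`. If both are squares, write `x + 1 = u ^
(q + 1)`, `x = v ^ (q + 1)`, `s = u + v`, `t = u - v`. Then `s * t = b`, and `s ^ q * t`, `s * t ^
q` are the roots of `Z ^ 2 - 2 * Z + b ^ (q + 1)`. For `b ≠ ±1` the solutions, if any, form two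
orbits of the fixed units of `x ↦ x ^ q` (`card_pairs`), giving `(q - 1) / 2` values of `x`. Two
nonsquares reduce to this case for `-b` by `x ↦ -1 - x`, and `b`, `-b` do not both occur
(`pairs_neg_eq_empty`). If the characters differ, the same quadratic has roots `ε * (u ± v) ^ (q +
1)`, so there is at most one `x` (`mixedFiber_subsingleton`), and there is one whenever the first
case occurs with `b ≠ ±1` (`mixedFiber_nonempty_of_pairs`). For `b = ±1` the quadratic has a double
root; this case is computed directly, and `x = 0, -1` contribute only here. The sizes of the
character classes then give the spectrum. -/

/-- The properties of the power map `x ↦ x ^ d` that determine its differential spectrum: it is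
even and sends `u ^ (q + 1)` to `u ^ 2`, where `q ≡ 3 mod 4`, `x ↦ x ^ q` is additive with `q`
fixed points, and every element of the field is, up to sign, a `(q + 1)`-st power. -/
structure IsTwistedSqrt {F : Type*} [Field F] (q : ℕ) (f : F → F) : Prop where
  mod_four : q % 4 = 3
  add_pow : ∀ a b : F, (a + b) ^ q = a ^ q + b ^ q
  not_isSquare_neg_one : ¬ IsSquare (-1 : F)
  exists_pow : ∀ x : F, ∃ u, x = u ^ (q + 1) ∨ x = -u ^ (q + 1)
  apply_pow : ∀ u : F, f (u ^ (q + 1)) = u ^ 2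
  apply_neg : ∀ x : F, f (-x) = f x
  card_fixed : Nat.card {c : Fˣ // c ^ (q - 1) = 1} = q - 1

/-! ### Arithmetic of the exponent, and the abstract properties of the power map. -/

lemma pow_mod_four_of_odd {a k : ℕ} (ha : a % 4 = 3) (hk : Odd k) : a ^ k % 4 = 3 := by
  obtain ⟨j, rfl⟩ := hk
  have : a ^ 2 % 4 = 1 := by simp [Nat.pow_mod, ha]
  rw [pow_succ, pow_mul, Nat.mul_mod, Nat.pow_mod, this, ha]
  simp

lemma exists_odd_mul_eq_pow_add_one {q : ℕ} (hq : Odd q) (j : ℕ) :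
    ∃ e, Odd e ∧ (q + 1) * e = q ^ (2 * j + 1) + 1 := by
  obtain ⟨r, rfl⟩ := hq
  induction j with
  | zero => exact ⟨1, odd_one, by ring⟩
  | succ j ih =>
    obtain ⟨e, ⟨t, rfl⟩, h⟩ := ih
    -- The new quotient is `q ^ 2 * e - (q - 1)`, rewritten without subtraction for `q = 2 * r + 1`,
    -- `e = 2 * t + 1`.
    refine ⟨2 * ((2 * r + 1) ^ 2 * t + 2 * r ^ 2 + r) + 1, ⟨_, rfl⟩, ?_⟩
    have : (2 * r + 1) ^ (2 * (j + 1) + 1) + (2 * r + 1) ^ 2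
        = (2 * r + 1) ^ 2 * ((2 * r + 1 + 1) * (2 * t + 1)) := by
      rw [h]; ring
    nlinarith

/-- With `e = (Q + 1) / (q + 1)`, both `e` and `(Q - 1) / 2` are odd, so `d` is even. Since `(q + 1)
* e = Q + 1`, `y ^ e` is a `(q + 1)`-st root of `y ^ 2`. As `q + 1` is even, the summand `(Q - 1) /
2` of `d` contributes to `(q + 1) * d` a multiple of `Q - 1`. -/
theorem isTwistedSqrt_pow {F : Type*} [Field F] [Finite F] {p n k d : ℕ}
    (hp : p.Prime) (hp4 : p % 4 = 3) (hn : Odd n) (hk : k ∣ n) (hF : Nat.card F = p ^ n)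
    (hd : d = (p ^ n + 1) / (p ^ k + 1) + (p ^ n - 1) / 2) :
    IsTwistedSqrt (p ^ k) (fun x : F => x ^ d) := by
  classical
  have := Fintype.ofFinite F
  obtain ⟨m, rfl⟩ := hk
  have hkm := Nat.odd_mul.1 hn
  obtain ⟨j, rfl⟩ := hkm.2
  have hq4 := pow_mod_four_of_odd hp4 hkm.1
  have hQ4 := pow_mod_four_of_odd hp4 hn
  have hFq : Fintype.card F = (p ^ k) ^ (2 * j + 1) := by
    rw [← Nat.card_eq_fintype_card, hF, pow_mul]
  rw [pow_mul] at hd hQ4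
  have hchar : CharP F p := by
    have : Fact p.Prime := ⟨hp⟩
    obtain ⟨c, hc⟩ := CharP.exists F
    have hcp := CharP.char_is_prime F c
    have : Fact c.Prime := ⟨hcp⟩
    obtain ⟨s, -, hs⟩ := FiniteField.card F c
    have : p ∣ c := by
      have h : p ∣ c ^ (s : ℕ) := by
        rw [← hs, ← Nat.card_eq_fintype_card, hF]
        exact dvd_pow_self p (by rintro h; simp [h] at hn)
      exact hp.dvd_of_dvd_pow h
    rwa [(Nat.prime_dvd_prime_iff_eq hp hcp).1 this]
  have : ExpChar F p := ExpChar.prime hp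
  have hadd : ∀ a b : F, (a + b) ^ p ^ k = a ^ p ^ k + b ^ p ^ k :=
    fun a b => add_pow_expChar_pow a b p k
  generalize p ^ k = q at *
  obtain ⟨e, he, heq⟩ := exists_odd_mul_eq_pow_add_one (Nat.odd_iff.2 (by omega) : Odd q) j
  have hd' : d = e + ((q ^ (2 * j + 1)) - 1) / 2 := by
    rw [hd, ← heq, Nat.mul_div_cancel_left _ (by omega)]
  have hde : Even d := by
    rw [hd', Nat.even_add]
    simp only [Nat.not_even_iff_odd.2 he, false_iff, Nat.not_even_iff_odd]
    rw [Nat.odd_iff]; omega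
  have hns : ¬ IsSquare (-1 : F) := by
    rw [FiniteField.isSquare_neg_one_iff, hFq]; omega
  have hch2 : ringChar F ≠ 2 := by
    intro h
    have := ringChar.of_eq h
    have h1 : (-1 : F) = 1 := CharTwo.neg_eq 1
    rw [h1] at hns
    exact hns IsSquare.one
  refine ⟨hq4, hadd, hns, ?_, ?_, fun x => hde.neg_pow x, ?_⟩
  · intro x
    have key : ∀ y : F, IsSquare y → ∃ u, y = u ^ (q + 1) := by
      rintro _ ⟨y, rfl⟩
      refine ⟨y ^ e, ?_⟩
      rw [← pow_mul, mul_comm e, heq, pow_succ, ← hFq, FiniteField.pow_card]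
    by_cases hx : IsSquare x
    · obtain ⟨u, hu⟩ := key x hx
      exact ⟨u, Or.inl hu⟩
    · have h2 : quadraticChar F (-x) = 1 := by
        rw [← neg_one_mul, map_mul, quadraticChar_neg_one_iff_not_isSquare.2 hns,
          quadraticChar_neg_one_iff_not_isSquare.2 hx]
        norm_num
      have hx0 : -x ≠ 0 := by
        rintro h
        simp [h] at h2
      obtain ⟨u, hu⟩ := key (-x) ((quadraticChar_one_iff_isSquare hx0).1 h2)
      exact ⟨u, Or.inr (by rw [← hu, neg_neg])⟩
  · intro u
    rcases eq_or_ne u 0 with rfl | hu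
    · have : d ≠ 0 := by
        obtain ⟨t, rfl⟩ := he
        omega
      simp [this]
    · have h1 : (q + 1) * d = (q ^ (2 * j + 1) + 1) + (q ^ (2 * j + 1) - 1) * ((q + 1) / 2) := by
        rw [hd', mul_add, heq]
        obtain ⟨a, ha⟩ : 2 ∣ q + 1 := by omega
        obtain ⟨b, hb⟩ : 2 ∣ q ^ (2 * j + 1) - 1 := by omega
        rw [ha, hb, Nat.mul_div_cancel_left _ two_pos, Nat.mul_div_cancel_left _ two_pos]
        ring
      change (u ^ (q + 1)) ^ d = _
      rw [← pow_mul, h1, pow_add, pow_mul, ← hFq, FiniteField.pow_card_sub_one_eq_one u hu,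
        pow_succ, FiniteField.pow_card, one_pow, mul_one, sq]
  · have h1 := IsCyclic.card_powMonoidHom_ker (G := Fˣ) (q - 1)
    rw [Nat.card_eq_fintype_card (α := Fˣ), Fintype.card_units, hFq,
      Nat.gcd_eq_right (Nat.sub_one_dvd_pow_sub_one q _)] at h1
    exact h1

/-- `x` is the `m`-th power of a nonzero element. -/
def IsUnitPow {F : Type*} [Field F] (m : ℕ) (x : F) : Prop := ∃ u, u ≠ 0 ∧ x = u ^ m

/-! ### The coordinates `s = u + v`, `t = u - v` and the quadratic behind them. -/

namespace IsTwistedSqrt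

variable {F : Type*} [Field F] {q : ℕ} {f : F → F}

lemma odd (h : IsTwistedSqrt q f) : Odd q := Nat.odd_iff.2 (by have := h.mod_four; omega)

lemma two_ne_zero (h : IsTwistedSqrt q f) : (2 : F) ≠ 0 := by
  intro h2
  have : (-1 : F) = 1 := by linear_combination -h2
  exact h.not_isSquare_neg_one (by rw [this]; exact IsSquare.one)

lemma neg_pow (h : IsTwistedSqrt q f) (a : F) : (-a) ^ q = -a ^ q := h.odd.neg_pow a

lemma sub_pow (h : IsTwistedSqrt q f) (a b : F) : (a - b) ^ q = a ^ q - b ^ q := by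
  rw [sub_eq_add_neg, h.add_pow, h.neg_pow, ← sub_eq_add_neg]

lemma two_pow (h : IsTwistedSqrt q f) : (2 : F) ^ q = 2 := by
  rw [← one_add_one_eq_two, h.add_pow, one_pow]

lemma eq_zero_of_sq_add_sq (h : IsTwistedSqrt q f) {a b : F} (hab : a ^ 2 + b ^ 2 = 0) :
    a = 0 ∧ b = 0 := by
  have hb : b = 0 := by
    by_contra hb
    refine h.not_isSquare_neg_one ⟨a / b, ?_⟩
    field_simp
    linear_combination -hab
  subst hb
  exact ⟨by simpa using hab, rfl⟩

lemma eq_zero_of_pow_add_pow (h : IsTwistedSqrt q f) {u v : F}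
    (huv : u ^ (q + 1) + v ^ (q + 1) = 0) : u = 0 ∧ v = 0 := by
  obtain ⟨r, hr⟩ : 2 ∣ q + 1 := by have := h.mod_four; omega
  rw [hr, mul_comm, pow_mul, pow_mul] at huv
  obtain ⟨h1, h2⟩ := h.eq_zero_of_sq_add_sq huv
  exact ⟨eq_zero_of_pow_eq_zero h1, eq_zero_of_pow_eq_zero h2⟩

/-- Applying `f` recovers `u ^ 2` from `u ^ (q + 1)`; conversely `q + 1` is even. -/
lemma pow_eq_pow_iff (h : IsTwistedSqrt q f) {u v : F} :
    u ^ (q + 1) = v ^ (q + 1) ↔ u ^ 2 = v ^ 2 := by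
  constructor
  · intro huv
    rw [← h.apply_pow, huv, h.apply_pow]
  · obtain ⟨r, hr⟩ : 2 ∣ q + 1 := by have := h.mod_four; omega
    intro huv
    rw [hr, pow_mul, huv, pow_mul]

lemma pow_eq_one_iff (h : IsTwistedSqrt q f) {u : F} : u ^ (q + 1) = 1 ↔ u ^ 2 = 1 := by
  simpa using h.pow_eq_pow_iff (u := u) (v := 1)

/-- `-1` is not a `(q - 1)`-st power. -/
lemma eq_zero_of_pow_eq_neg (h : IsTwistedSqrt q f) {c : F} (hc : c ^ q = -c) : c = 0 := by
  have h1 : c ^ (q + 1) + c ^ 2 = 0 := by rw [pow_succ, hc]; ring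
  obtain ⟨r, hr⟩ : 2 ∣ q + 1 := by have := h.mod_four; omega
  rw [hr, mul_comm, pow_mul] at h1
  exact (h.eq_zero_of_sq_add_sq h1).2

lemma isUnitPow_ne_zero {x : F} (hx : IsUnitPow (q + 1) x) : x ≠ 0 := by
  obtain ⟨u, hu, rfl⟩ := hx
  exact pow_ne_zero _ hu

lemma isUnitPow_or (h : IsTwistedSqrt q f) {x : F} (hx : x ≠ 0) :
    IsUnitPow (q + 1) x ∨ IsUnitPow (q + 1) (-x) := by
  obtain ⟨u, hu⟩ := h.exists_pow x
  have hu0 : u ≠ 0 := by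
    rintro rfl
    simp at hu
    exact hx hu
  exact hu.imp (fun e => ⟨u, hu0, e⟩) fun e => ⟨u, hu0, by rw [e, neg_neg]⟩

lemma not_isUnitPow_neg (h : IsTwistedSqrt q f) {x : F} (hx : IsUnitPow (q + 1) x) :
    ¬ IsUnitPow (q + 1) (-x) := by
  rintro ⟨v, hv, e⟩
  obtain ⟨u, hu, rfl⟩ := hx
  exact hu (h.eq_zero_of_pow_add_pow (u := u) (v := v) (by rw [← e]; ring)).1

lemma isUnitPow_mul {m : ℕ} {x y : F} (hx : IsUnitPow m x) (hy : IsUnitPow m y) :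
    IsUnitPow m (x * y) := by
  obtain ⟨u, hu, rfl⟩ := hx
  obtain ⟨v, hv, rfl⟩ := hy
  exact ⟨u * v, mul_ne_zero hu hv, (mul_pow u v m).symm⟩

lemma isUnitPow_div {m : ℕ} {x y : F} (hx : IsUnitPow m x) (hy : IsUnitPow m y) :
    IsUnitPow m (x / y) := by
  obtain ⟨u, hu, rfl⟩ := hx
  obtain ⟨v, hv, rfl⟩ := hy
  exact ⟨u / v, div_ne_zero hu hv, (div_pow u v m).symm⟩

/-- By Vieta, the conjugate products of both pairs are the roots of one quadratic. -/
lemma pow_mul_eq_or {s t s' t' : F} (hprod : (s' * t') ^ (q + 1) = (s * t) ^ (q + 1))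
    (hsum : s' ^ q * t' + s' * t' ^ q = s ^ q * t + s * t ^ q) :
    s' ^ q * t' = s ^ q * t ∨ s' ^ q * t' = s * t ^ q := by
  have : (s' ^ q * t' - s ^ q * t) * (s' ^ q * t' - s * t ^ q) = 0 := by
    simp only [mul_pow, pow_succ] at hprod
    linear_combination (s' ^ q * t') * hsum - hprod
  simpa [sub_eq_zero] using this

lemma div_fixed {s t s' t' : F} (hb : s' * t' = s * t) (h0 : s * t ≠ 0)
    (e : s' ^ q * t' = s ^ q * t) : (s' / s) ^ q = s' / s := by
  have hs := left_ne_zero_of_mul h0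
  have ht := right_ne_zero_of_mul h0
  have ht' := right_ne_zero_of_mul (hb ▸ h0)
  rw [div_pow, div_eq_div_iff (pow_ne_zero _ hs) hs]
  apply mul_right_cancel₀ (mul_ne_zero ht' ht)
  linear_combination s * t * e - s ^ q * t * hb

/-- Used for contradictions: `eq_zero_of_pow_eq_neg` rules out such a nonzero ratio. -/
lemma div_pow_eq_neg {s t s' t' : F} (hb : s' * t' = -(s * t)) (h0 : s * t ≠ 0)
    (e : s' ^ q * t' = s ^ q * t) : (s' / s) ^ q = -(s' / s) := by
  have hs := left_ne_zero_of_mul h0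
  have ht := right_ne_zero_of_mul h0
  have ht' := right_ne_zero_of_mul (hb ▸ neg_ne_zero.2 h0)
  rw [div_pow, ← neg_div, div_eq_div_iff (pow_ne_zero _ hs) hs]
  apply mul_right_cancel₀ (mul_ne_zero ht' ht)
  linear_combination s * t * e + s ^ q * t * hb

variable [Fintype F]

open Classical in
/-- The elements `x` such that `x` and `x + 1` are both `(q + 1)`-st powers of units, in the
fibre over `b` of the derivative of `f`. -/
noncomputable def sameFiber (q : ℕ) (f : F → F) (b : F) : Finset F :=
  {x | IsUnitPow (q + 1) x ∧ IsUnitPow (q + 1) (x + 1) ∧ f (x + 1) - f x = b}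

open Classical in
/-- The elements `x` such that `x` and `x + 1` differ in quadratic character, in the
fibre over `b` of the derivative of `f`. -/
noncomputable def mixedFiber (q : ℕ) (f : F → F) (b : F) : Finset F :=
  {x | (IsUnitPow (q + 1) (x + 1) ∧ IsUnitPow (q + 1) (-x) ∨
    IsUnitPow (q + 1) (-(x + 1)) ∧ IsUnitPow (q + 1) x) ∧ f (x + 1) - f x = b}

open Classical in
/-- Solutions of the two equations that describe `sameFiber q f b` in the coordinates
`s = u + v`, `t = u - v`, where `x + 1 = u ^ (q + 1)` and `x = v ^ (q + 1)`. -/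
noncomputable def pairs (q : ℕ) (b : F) : Finset (F × F) :=
  {p | p.1 * p.2 = b ∧ p.1 ^ q * p.2 + p.1 * p.2 ^ q = 2 ∧ p.1 ^ 2 ≠ p.2 ^ 2}

lemma mem_pairs {b : F} {s t : F} : (s, t) ∈ pairs q b ↔
    s * t = b ∧ s ^ q * t + s * t ^ q = 2 ∧ s ^ 2 ≠ t ^ 2 := by
  simp [pairs]

lemma card_sq_eq (h : IsTwistedSqrt q f) [DecidableEq F] {u : F} (hu : u ≠ 0) :
    #{x : F | x ^ 2 = u ^ 2} = 2 := by
  have : ({x : F | x ^ 2 = u ^ 2} : Finset F) = {u, -u} := by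
    ext x
    simp [sq_eq_sq_iff_eq_or_eq_neg]
  rw [this, card_pair]
  intro e
  have : 2 * u = 0 := by linear_combination e
  exact (mul_ne_zero h.two_ne_zero hu) this

/-- Each `x` comes from the four choices `(±u, ±v)`. In the new coordinates `s ^ q * t + s * t ^ q =
2 * (u ^ (q + 1) - v ^ (q + 1))`, and `s ^ 2 - t ^ 2 = 4 * u * v`, so `s ^ 2 ≠ t ^ 2` says that `u`
and `v` are nonzero. -/
lemma four_mul_card_sameFiber (h : IsTwistedSqrt q f) (b : F) :
    4 * #(sameFiber q f b) = #(pairs q b) := by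
  classical
  let T : Finset (F × F) :=
    {p | p.1 ≠ 0 ∧ p.2 ≠ 0 ∧ p.1 ^ (q + 1) = p.2 ^ (q + 1) + 1 ∧ p.1 ^ 2 - p.2 ^ 2 = b}
  have h1 : #T = #(pairs q b) := by
    have h2 := h.two_ne_zero
    refine card_nbij' (fun p => (p.1 + p.2, p.1 - p.2))
      (fun p => ((p.1 + p.2) / 2, (p.1 - p.2) / 2)) ?_ ?_ ?_ ?_
    · rintro ⟨u, v⟩ huv
      simp only [T, coe_filter, mem_univ, true_and, Set.mem_ofPred_eq] at huv
      obtain ⟨hu, hv, e, hb⟩ := huv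
      rw [mem_coe, mem_pairs, h.add_pow, h.sub_pow]
      simp only [pow_succ] at e
      refine ⟨by linear_combination hb, by linear_combination 2 * e, fun e' => ?_⟩
      have : (2 * 2 * u * v) = 0 := by linear_combination e'
      simp [h2, hu, hv] at this
    · rintro ⟨s, t⟩ hst
      rw [mem_coe, mem_pairs] at hst
      obtain ⟨hb, e, hne⟩ := hst
      simp only [T, coe_filter, mem_univ, true_and, Set.mem_ofPred_eq, pow_succ, div_pow, h.add_pow,
        h.sub_pow, h.two_pow]
      refine ⟨fun e' => hne ?_, fun e' => hne ?_, ?_, ?_⟩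
      · have : s + t = 0 := by simpa [h2] using e'
        linear_combination (s - t) * this
      · have : s - t = 0 := by simpa [h2] using e'
        linear_combination (s + t) * this
      · field_simp
        linear_combination 2 * e
      · field_simp
        linear_combination 4 * hb
    · rintro ⟨u, v⟩ -
      ext <;> simp <;> field_simp <;> ring
    · rintro ⟨u, v⟩ -
      ext <;> simp <;> field_simp <;> ring
  rw [← h1, card_eq_sum_card_fiberwise (f := fun p : F × F => p.2 ^ (q + 1))
    (t := sameFiber q f b)]
  · rw [sum_const_nat (m := 4), mul_comm]
    intro x hx
    simp only [sameFiber, mem_filter, mem_univ, true_and] at hx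
    obtain ⟨⟨v, hv, rfl⟩, ⟨u, hu, e⟩, hb⟩ := hx
    rw [e, h.apply_pow, h.apply_pow] at hb
    have : ({p ∈ T | p.2 ^ (q + 1) = v ^ (q + 1)} : Finset (F × F)) =
        ({x : F | x ^ 2 = u ^ 2} : Finset F) ×ˢ ({x : F | x ^ 2 = v ^ 2} : Finset F) := by
      ext ⟨u', v'⟩
      simp only [T, mem_filter, mem_univ, true_and, mem_product]
      constructor
      · rintro ⟨⟨hu', hv', e1, e2⟩, e3⟩
        rw [← h.pow_eq_pow_iff, ← h.pow_eq_pow_iff, e1, e3, e]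
        exact ⟨rfl, rfl⟩
      · rintro ⟨e1, e2⟩
        refine ⟨⟨?_, ?_, ?_, ?_⟩, h.pow_eq_pow_iff.2 e2⟩
        · rintro rfl
          exact hu (by simpa using e1.symm)
        · rintro rfl
          exact hv (by simpa using e2.symm)
        · rw [h.pow_eq_pow_iff.2 e1, h.pow_eq_pow_iff.2 e2, e]
        · rw [e1, e2, hb]
    rw [this, card_product, h.card_sq_eq hu, h.card_sq_eq hv]
  · rintro ⟨u, v⟩ huv
    simp only [T, coe_filter, mem_univ, true_and, Set.mem_ofPred_eq] at huv
    obtain ⟨hu, hv, e, hb⟩ := huv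
    simp only [sameFiber, coe_filter, mem_univ, true_and, Set.mem_ofPred_eq]
    refine ⟨⟨v, hv, rfl⟩, ⟨u, hu, e.symm⟩, ?_⟩
    rw [← e, h.apply_pow, h.apply_pow, hb]

end IsTwistedSqrt

/-! ### Counting `pairs q b`. -/

namespace IsTwistedSqrt

variable {F : Type*} [Field F] {q : ℕ} {f : F → F} [Fintype F]

open Classical in
/-- The nonzero fixed points of `x ↦ x ^ q`. -/
noncomputable def fixedUnits (q : ℕ) (F : Type*) [Field F] [Fintype F] : Finset F :=
  {c | c ≠ 0 ∧ c ^ q = c}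

lemma mem_fixedUnits {c : F} : c ∈ fixedUnits q F ↔ c ≠ 0 ∧ c ^ q = c := by
  simp [fixedUnits]

lemma card_fixedUnits (h : IsTwistedSqrt q f) : #(fixedUnits q F) = q - 1 := by
  classical
  rw [← h.card_fixed, Nat.card_eq_fintype_card, Fintype.card_subtype]
  obtain ⟨r, hr⟩ : ∃ r, q = r + 1 := ⟨q - 1, by have := h.mod_four; omega⟩
  symm
  refine card_bij (fun c _ => (c : F)) ?_ (fun _ _ _ _ e => Units.ext e) ?_
  · intro c hc
    simp only [mem_filter, mem_univ, true_and] at hc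
    rw [mem_fixedUnits]
    refine ⟨c.ne_zero, ?_⟩
    rw [← Units.val_pow_eq_pow_val]
    congr 1
    rw [hr, Nat.add_sub_cancel] at hc
    rw [hr, pow_succ, hc, one_mul]
  · intro c hc
    rw [mem_fixedUnits] at hc
    refine ⟨Units.mk0 c hc.1, ?_, rfl⟩
    simp only [mem_filter, mem_univ, true_and]
    ext
    have h2 := hc.2
    rw [hr, pow_succ] at h2
    simpa [hr, hc.1] using h2

lemma ne_zero_of_mem_pairs (h : IsTwistedSqrt q f) {b : F} {p : F × F} (hp : p ∈ pairs q b) :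
    b ≠ 0 := by
  obtain ⟨s, t⟩ := p
  rw [mem_pairs] at hp
  obtain ⟨rfl, e, -⟩ := hp
  intro h0
  have hq : q ≠ 0 := by have := h.mod_four; omega
  rcases mul_eq_zero.1 h0 with rfl | rfl <;> simp [hq] at e <;> exact h.two_ne_zero e.symm

/-- `pairs q b` and `pairs q (-b)` are not both nonempty. -/
lemma pairs_neg_eq_empty (h : IsTwistedSqrt q f) {b : F} (hb : (pairs q b).Nonempty) :
    pairs q (-b) = ∅ := by
  rw [← not_nonempty_iff_eq_empty]
  rintro ⟨⟨s', t'⟩, hp'⟩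
  obtain ⟨⟨s, t⟩, hp⟩ := hb
  have hb0 := h.ne_zero_of_mem_pairs hp
  rw [mem_pairs] at hp hp'
  obtain ⟨rfl, e, -⟩ := hp
  obtain ⟨hb', e', -⟩ := hp'
  have hs'0 : s' ≠ 0 := left_ne_zero_of_mul (hb' ▸ neg_ne_zero.2 hb0)
  have hev : Even (q + 1) := h.odd.add_one
  -- `q + 1` is even, so `b` and `-b` give the same quadratic. Matching roots makes `s' / s` or `s'
  -- / t` a nonzero `c` with `c ^ q = -c`.
  rcases pow_mul_eq_or (q := q) (by rw [hb', hev.neg_pow]) (e'.trans e.symm) with e1 | e1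
  · exact div_ne_zero hs'0 (left_ne_zero_of_mul hb0)
      (h.eq_zero_of_pow_eq_neg (div_pow_eq_neg hb' hb0 e1))
  · rw [mul_comm s t] at hb' hb0
    rw [mul_comm s] at e1
    exact div_ne_zero hs'0 (left_ne_zero_of_mul hb0)
      (h.eq_zero_of_pow_eq_neg (div_pow_eq_neg hb' hb0 e1))

/-- For `b ≠ ±1` the two conjugate products attached to a pair differ. -/
lemma pow_mul_ne_mul_pow (h : IsTwistedSqrt q f) {b s t : F} (hb1 : b ≠ 1) (hb2 : b ≠ -1)
    (hp : (s, t) ∈ pairs q b) : s ^ q * t ≠ s * t ^ q := by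
  rw [mem_pairs] at hp
  obtain ⟨rfl, e, -⟩ := hp
  intro e'
  -- Equal products with sum `2` are both `1`, whence `b ^ (q + 1) = 1`.
  have h1 : s ^ q * t = 1 := mul_left_cancel₀ h.two_ne_zero (by linear_combination e + e')
  have h2 : (s * t) ^ (q + 1) = 1 := by
    rw [mul_pow, pow_succ, pow_succ]
    linear_combination (s * t ^ q + 1) * h1 - e'
  have h3 := h.pow_eq_one_iff.1 h2
  rw [← one_pow 2, sq_eq_sq_iff_eq_or_eq_neg] at h3
  rcases h3 with e | e
  · exact hb1 e
  · exact hb2 e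

/-- The fixed units act by `(s, t) ↦ (c * s, t / c)`. Up to exchanging `s` and `t`, any other
solution has the same root `s ^ q * t`, hence lies in the same orbit. The two orbits are disjoint
because the two roots differ. -/
lemma card_pairs (h : IsTwistedSqrt q f) {b : F} (hb1 : b ≠ 1) (hb2 : b ≠ -1)
    (hb : (pairs q b).Nonempty) : #(pairs q b) = 2 * (q - 1) := by
  classical
  obtain ⟨⟨s, t⟩, hp⟩ := hb
  have hne := h.pow_mul_ne_mul_pow hb1 hb2 hp
  have hb0 := h.ne_zero_of_mem_pairs hp
  rw [mem_pairs] at hp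
  obtain ⟨hst, e, -⟩ := hp
  have hs : s ≠ 0 := by rintro rfl; simp at hst; exact hb0 hst.symm
  have ht : t ≠ 0 := by rintro rfl; simp at hst; exact hb0 hst.symm
  have key : pairs q b = (fixedUnits q F).image (fun c => (c * s, t / c)) ∪
      (fixedUnits q F).image (fun c => (c * t, s / c)) := by
    have hsub : ∀ s t : F, s * t = b → s ^ q * t + s * t ^ q = 2 → s ^ q * t ≠ s * t ^ q →
        ∀ c ∈ fixedUnits q F, (c * s, t / c) ∈ pairs q b := by
      intro s t hst e hne c hc
      rw [mem_fixedUnits] at hc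
      obtain ⟨hc0, hc⟩ := hc
      rw [mem_pairs, mul_pow, div_pow, hc]
      refine ⟨by field_simp; exact hst, by field_simp; exact e, fun h4 => hne ?_⟩
      -- From `c ^ 2 * s = ±t`, the `q`-th power map gives `c ^ 2 * s ^ q = ±t ^ q`, so the two
      -- roots would agree.
      rcases sq_eq_sq_iff_eq_or_eq_neg.1 h4 with h5 | h5 <;>
      · have h6 := congrArg (· ^ q) h5
        simp only [h.neg_pow, mul_pow, div_pow, hc] at h6
        field_simp at h5 h6
        apply mul_left_cancel₀ (pow_ne_zero 2 hc0)
        linear_combination t * h6 - t ^ q * h5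
    ext ⟨s', t'⟩
    simp only [mem_union, mem_image, Prod.mk.injEq]
    constructor
    · intro hp
      rw [mem_pairs] at hp
      obtain ⟨hst', e', -⟩ := hp
      have hs' : s' ≠ 0 := by rintro rfl; simp at hst'; exact hb0 hst'.symm
      have ht' : t' = b / s' := by field_simp; linear_combination hst'
      rcases pow_mul_eq_or (q := q) (by rw [hst, hst']) (e'.trans e.symm) with e1 | e1
      · left
        refine ⟨s' / s, mem_fixedUnits.2 ⟨div_ne_zero hs' hs,
          div_fixed (hst'.trans hst.symm) (hst ▸ hb0) e1⟩, by field_simp, ?_⟩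
        rw [ht', ← hst]
        field_simp
      · right
        rw [mul_comm] at hst
        rw [mul_comm s] at e1
        refine ⟨s' / t, mem_fixedUnits.2 ⟨div_ne_zero hs' ht,
          div_fixed (hst'.trans hst.symm) (hst ▸ hb0) e1⟩, by field_simp, ?_⟩
        rw [ht', ← hst]
        field_simp
    · rintro (⟨c, hc, rfl, rfl⟩ | ⟨c, hc, rfl, rfl⟩)
      · exact hsub s t hst e hne c hc
      · exact hsub t s (by rw [mul_comm, hst]) (by linear_combination e)
          (fun e => hne (by linear_combination -e)) c hc
  rw [key, card_union_of_disjoint, card_image_of_injOn, card_image_of_injOn, h.card_fixedUnits]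
  · ring
  · intro c _ c' _ e
    simpa [ht] using congrArg Prod.fst e
  · intro c _ c' _ e
    simpa [hs] using congrArg Prod.fst e
  · rw [disjoint_left]
    simp only [mem_image, not_exists, not_and]
    rintro _ ⟨c, hc, rfl⟩ c' hc' e'
    simp only [Prod.mk.injEq] at e'
    rw [mem_fixedUnits] at hc hc'
    have h1 : c' ^ q * t ^ q = c ^ q * s ^ q := by rw [← mul_pow, ← mul_pow, e'.1]
    rw [hc.2, hc'.2] at h1
    apply hne
    apply mul_left_cancel₀ hc.1
    linear_combination t ^ q * e'.1 - t * h1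

/-- Compare with `(1, 1)`, which has the same double root `1` although it lies in no set `pairs q
b`: this would give `s ^ q = -s`. -/
lemma pairs_neg_one (h : IsTwistedSqrt q f) : pairs q (-1 : F) = ∅ := by
  rw [eq_empty_iff_forall_notMem]
  rintro ⟨s, t⟩ hp
  rw [mem_pairs] at hp
  obtain ⟨hst, e, -⟩ := hp
  have hev : Even (q + 1) := h.odd.add_one
  rcases pow_mul_eq_or (q := q) (s := 1) (t := 1) (s' := s) (t' := t)
    (by rw [hst, hev.neg_pow]; simp) (by rw [e]; norm_num) with e1 | e1 <;>
  · have := h.eq_zero_of_pow_eq_neg (div_pow_eq_neg (s := 1) (t := 1) (s' := s) (t' := t)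
      (by rw [hst]; simp) (by simp) (by simpa using e1))
    simp at this
    simp [this] at hst

/-- Comparison with `(1, 1)` gives `s ^ q = s` and `t = s⁻¹`. The condition `s ^ 2 ≠ t ^ 2` excludes
`s ^ 4 = 1`, that is `s = ±1`, because `-1` is not a square. -/
lemma card_pairs_one (h : IsTwistedSqrt q f) : #(pairs q (1 : F)) = q - 3 := by
  classical
  have h1 : (1 : F) ≠ -1 := fun e => h.two_ne_zero (by linear_combination e)
  have h2 : #(pairs q (1 : F)) = #(fixedUnits q F \ {1, -1}) := by
    refine card_nbij' Prod.fst (fun c => (c, c⁻¹)) ?_ ?_ ?_ ?_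
    · rintro ⟨s, t⟩ hp
      rw [mem_coe, mem_pairs] at hp
      obtain ⟨hst, e, hne⟩ := hp
      have := div_fixed (q := q) (s := 1) (t := 1) (s' := s) (t' := t) (by simpa using hst)
        (by simp) ((pow_mul_eq_or (q := q) (s := 1) (t := 1) (s' := s) (t' := t)
          (by simp [hst]) (by rw [e]; norm_num)).elim id (by simp))
      simp only [coe_sdiff, coe_insert, coe_singleton, Set.mem_sdiff, mem_coe, mem_fixedUnits,
        Set.mem_insert_iff, Set.mem_singleton_iff, not_or]
      refine ⟨⟨by rintro rfl; simp at hst, by simpa using this⟩, ?_, ?_⟩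
      · rintro rfl
        simp at hst
        simp [hst] at hne
      · rintro rfl
        apply hne
        linear_combination (t - 1) * hst
    · intro c hc
      simp only [coe_sdiff, coe_insert, coe_singleton, Set.mem_sdiff, mem_coe, mem_fixedUnits,
        Set.mem_insert_iff, Set.mem_singleton_iff, not_or] at hc
      obtain ⟨⟨hc0, hc⟩, hc1, hc2⟩ := hc
      rw [mem_coe, mem_pairs, inv_pow, hc]
      refine ⟨by field_simp, by field_simp; norm_num, fun e => ?_⟩
      field_simp at e
      have : (c - 1) * (c + 1) * (c ^ 2 + 1) = 0 := by linear_combination e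
      have h3 : c ^ 2 + 1 ≠ 0 := fun e3 =>
        hc0 (h.eq_zero_of_sq_add_sq (b := 1) (by linear_combination e3)).1
      simp [h3, sub_eq_zero, hc1, add_eq_zero_iff_eq_neg, hc2] at this
    · rintro ⟨s, t⟩ hp
      rw [mem_coe, mem_pairs] at hp
      have hs : s ≠ 0 := by rintro rfl; simp at hp
      ext
      · rfl
      · simp only
        field_simp
        exact hp.1.symm
    · intro c _
      rfl
  rw [h2, card_sdiff_of_subset, h.card_fixedUnits, card_pair h1]
  · omega
  · intro c hc
    simp only [mem_insert, mem_singleton] at hc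
    rw [mem_fixedUnits]
    rcases hc with rfl | rfl
    · simp
    · exact ⟨by simp, by rw [h.neg_pow, one_pow]⟩

end IsTwistedSqrt

/-! ### Elements `x` with `x` and `x + 1` of different character. -/

namespace IsTwistedSqrt

variable {F : Type*} [Field F] {q : ℕ} {f : F → F}

/-- Equal signs determine `(u + v) ^ 2` and `(u - v) ^ 2`, hence `u ^ 2`. Opposite signs make two
sums of `(q + 1)`-st powers vanish, forcing `u = 0`. -/
lemma sq_eq_sq_of_mixed (h : IsTwistedSqrt q f) {ε u v ε' u' v' : F}
    (hε : ε = 1 ∨ ε = -1) (hε' : ε' = 1 ∨ ε' = -1) (hu : u ≠ 0)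
    (hb : u ^ 2 - v ^ 2 = u' ^ 2 - v' ^ 2)
    (h1 : ε * (u + v) ^ (q + 1) = ε' * (u' + v') ^ (q + 1))
    (h2 : ε * (u - v) ^ (q + 1) = ε' * (u' - v') ^ (q + 1)) : ε = ε' ∧ u ^ 2 = u' ^ 2 := by
  by_cases hεε : ε = ε'
  · subst hεε
    have hε0 : ε ≠ 0 := by rcases hε with rfl | rfl <;> simp
    have h3 := h.pow_eq_pow_iff.1 (mul_left_cancel₀ hε0 h1)
    have h4 := h.pow_eq_pow_iff.1 (mul_left_cancel₀ hε0 h2)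
    refine ⟨rfl, ?_⟩
    apply mul_left_cancel₀ (mul_ne_zero h.two_ne_zero h.two_ne_zero)
    linear_combination h3 + h4 + 2 * hb
  · have hε'' : ε' = -ε := by
      rcases hε with rfl | rfl <;> rcases hε' with rfl | rfl <;> simp at hεε ⊢
    subst hε''
    have hε0 : ε ≠ 0 := by rcases hε with rfl | rfl <;> simp
    have h3 : u + v = 0 := (h.eq_zero_of_pow_add_pow (v := u' + v')
      (mul_left_cancel₀ hε0 (by linear_combination h1))).1
    have h4 : u - v = 0 := (h.eq_zero_of_pow_add_pow (v := u' - v')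
      (mul_left_cancel₀ hε0 (by linear_combination h2))).1
    have : 2 * u = 0 := by linear_combination h3 + h4
    simp [h.two_ne_zero, hu] at this

/-- The sum and the product of `(u + v) ^ (q + 1)` and `(u - v) ^ (q + 1)`. -/
lemma add_sub_pow_add (h : IsTwistedSqrt q f) (u v : F) :
    (u + v) ^ (q + 1) + (u - v) ^ (q + 1) = 2 * (u ^ (q + 1) + v ^ (q + 1)) := by
  simp only [pow_succ, h.add_pow, h.sub_pow]
  ring

variable [Fintype F]

lemma mem_sameFiber {b x : F} : x ∈ sameFiber q f b ↔
    IsUnitPow (q + 1) x ∧ IsUnitPow (q + 1) (x + 1) ∧ f (x + 1) - f x = b := by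
  simp [sameFiber]

lemma mem_mixedFiber {b x : F} : x ∈ mixedFiber q f b ↔
    (IsUnitPow (q + 1) (x + 1) ∧ IsUnitPow (q + 1) (-x) ∨
      IsUnitPow (q + 1) (-(x + 1)) ∧ IsUnitPow (q + 1) x) ∧ f (x + 1) - f x = b := by
  simp [mixedFiber]

lemma mem_mixedFiber_iff (h : IsTwistedSqrt q f) {b x : F} : x ∈ mixedFiber q f b ↔
    ∃ ε u v : F, (ε = 1 ∨ ε = -1) ∧ u ≠ 0 ∧ v ≠ 0 ∧ x + 1 = ε * u ^ (q + 1) ∧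
      -x = ε * v ^ (q + 1) ∧ u ^ 2 - v ^ 2 = b := by
  rw [mem_mixedFiber]
  constructor
  · rintro ⟨⟨⟨u, hu, eu⟩, v, hv, ev⟩ | ⟨⟨u, hu, eu⟩, v, hv, ev⟩, hb⟩
    · refine ⟨1, u, v, Or.inl rfl, hu, hv, by rw [eu, one_mul], by rw [ev, one_mul], ?_⟩
      rw [← h.apply_pow, ← h.apply_pow, ← eu, ← ev, h.apply_neg, hb]
    · refine ⟨-1, u, v, Or.inr rfl, hu, hv, by rw [← eu]; ring, by rw [← ev]; ring, ?_⟩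
      rw [← h.apply_pow, ← h.apply_pow, ← eu, ← ev, h.apply_neg, hb]
  · rintro ⟨ε, u, v, hε, hu, hv, eu, ev, hb⟩
    rw [← h.apply_neg x, ev, eu]
    rcases hε with rfl | rfl
    · exact ⟨Or.inl ⟨⟨u, hu, one_mul _⟩, v, hv, one_mul _⟩, by
        rw [one_mul, one_mul, h.apply_pow, h.apply_pow, hb]⟩
    · refine ⟨Or.inr ⟨⟨u, hu, by ring⟩, v, hv, by linear_combination -ev⟩, ?_⟩
      rw [neg_one_mul, neg_one_mul, h.apply_neg, h.apply_neg, h.apply_pow, h.apply_pow, hb]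

/-- The elements `ε * (u ± v) ^ (q + 1)` have sum `2` and product `b ^ (q + 1)`, so they are
determined up to order; exchanging them amounts to replacing `v'` by `-v'`. -/
lemma mixedFiber_subsingleton (h : IsTwistedSqrt q f) {b x y : F} (hx : x ∈ mixedFiber q f b)
    (hy : y ∈ mixedFiber q f b) : x = y := by
  rw [h.mem_mixedFiber_iff] at hx hy
  obtain ⟨ε, u, v, hε, hu, hv, eu, ev, hb⟩ := hx
  obtain ⟨ε', u', v', hε', hu', hv', eu', ev', hb'⟩ := hy
  have hs := h.add_sub_pow_add u v
  have hs' := h.add_sub_pow_add u' v'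
  have hp : (u + v) ^ (q + 1) * (u - v) ^ (q + 1) =
      (u' + v') ^ (q + 1) * (u' - v') ^ (q + 1) := by
    rw [← mul_pow, ← mul_pow]
    congr 1
    linear_combination hb - hb'
  have hε2 : ε ^ 2 = 1 := by rcases hε with rfl | rfl <;> simp
  have hε2' : ε' ^ 2 = 1 := by rcases hε' with rfl | rfl <;> simp
  have hsum : ε * (u + v) ^ (q + 1) + ε * (u - v) ^ (q + 1) =
      ε' * (u' + v') ^ (q + 1) + ε' * (u' - v') ^ (q + 1) := by
    linear_combination ε * hs - ε' * hs' - 2 * eu - 2 * ev + 2 * eu' + 2 * ev'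
  have hprod : ε * (u + v) ^ (q + 1) * (ε * (u - v) ^ (q + 1)) =
      ε' * (u' + v') ^ (q + 1) * (ε' * (u' - v') ^ (q + 1)) := by
    linear_combination hp + ((u + v) ^ (q + 1) * (u - v) ^ (q + 1)) * hε2 -
      ((u' + v') ^ (q + 1) * (u' - v') ^ (q + 1)) * hε2'
  have hor : (ε * (u + v) ^ (q + 1) - ε' * (u' + v') ^ (q + 1)) *
      (ε * (u + v) ^ (q + 1) - ε' * (u' - v') ^ (q + 1)) = 0 := by
    linear_combination ε * (u + v) ^ (q + 1) * hsum - hprod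
  have key : ε = ε' ∧ u ^ 2 = u' ^ 2 := by
    rcases mul_eq_zero.1 hor with e | e
    · exact h.sq_eq_sq_of_mixed (v := v) (v' := v') hε hε' hu (by rw [hb, hb'])
        (by linear_combination e) (by linear_combination hsum - e)
    · refine h.sq_eq_sq_of_mixed (v := v) (v' := -v') hε hε' hu (by rw [neg_sq, hb, hb']) ?_ ?_
      · rw [← sub_eq_add_neg]; linear_combination e
      · rw [sub_neg_eq_add]; linear_combination hsum - e
  have : x + 1 = y + 1 := by rw [eu, eu', key.1, h.pow_eq_pow_iff.2 key.2]
  exact add_right_cancel this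

/-- Now the quadratic is `(Z - 1) ^ 2`, so `(u + v) ^ 2 = (u - v) ^ 2` and `u * v = 0`. -/
lemma mixedFiber_eq_empty (h : IsTwistedSqrt q f) {b : F} (hb : b = 1 ∨ b = -1) :
    mixedFiber q f b = ∅ := by
  rw [eq_empty_iff_forall_notMem]
  intro x hx
  rw [h.mem_mixedFiber_iff] at hx
  obtain ⟨ε, u, v, hε, hu, hv, eu, ev, hb'⟩ := hx
  have hs := h.add_sub_pow_add u v
  have hev : Even (q + 1) := h.odd.add_one
  have hb1 : b ^ (q + 1) = 1 := by
    rcases hb with rfl | rfl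
    · simp
    · rw [hev.neg_pow, one_pow]
  have hp : (u + v) ^ (q + 1) * (u - v) ^ (q + 1) = 1 := by
    rw [← hb1, ← mul_pow, ← hb']
    congr 1
    ring
  have hε2 : ε ^ 2 = 1 := by rcases hε with rfl | rfl <;> simp
  have h1 : ((u + v) ^ (q + 1) - ε) ^ 2 = 0 := by
    have : ε * ((u + v) ^ (q + 1) + (u - v) ^ (q + 1)) = 2 := by
      linear_combination ε * hs - 2 * eu - 2 * ev
    linear_combination -hp + ε * (u + v) ^ (q + 1) * this + hε2 -
      (u + v) ^ (q + 1) * ((u + v) ^ (q + 1) + (u - v) ^ (q + 1)) * hε2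
  have h2 : (u + v) ^ (q + 1) = ε := by simpa [sub_eq_zero] using h1
  have h3 : (u + v) ^ (q + 1) = (u - v) ^ (q + 1) := by
    rw [h2] at hp ⊢
    linear_combination -ε * hp + (u - v) ^ (q + 1) * hε2
  have h4 := h.pow_eq_pow_iff.1 h3
  have : 2 * 2 * u * v = 0 := by linear_combination h4
  simp [h.two_ne_zero, hu, hv] at this

/-- The root `s ^ q * t` equals `ε * σ ^ (q + 1)` for some `σ`. With `τ = b / σ` the other root is
`ε * τ ^ (q + 1)`, and `σ = u + v`, `τ = u - v` are solved for `u` and `v`. -/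
lemma mixedFiber_nonempty_of_pairs (h : IsTwistedSqrt q f) {b : F} (hb1 : b ≠ 1) (hb2 : b ≠ -1)
    (hb : (pairs q b).Nonempty) : (mixedFiber q f b).Nonempty := by
  obtain ⟨⟨s, t⟩, hp⟩ := hb
  have hne := h.pow_mul_ne_mul_pow hb1 hb2 hp
  have hb0 := h.ne_zero_of_mem_pairs hp
  rw [mem_pairs] at hp
  obtain ⟨hst, e, -⟩ := hp
  have hs : s ≠ 0 := by rintro rfl; simp at hst; exact hb0 hst.symm
  have ht : t ≠ 0 := by rintro rfl; simp at hst; exact hb0 hst.symm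
  obtain ⟨ε, σ, hε, hσ⟩ : ∃ ε σ : F, (ε = 1 ∨ ε = -1) ∧ s ^ q * t = ε * σ ^ (q + 1) := by
    obtain ⟨σ, hσ | hσ⟩ := h.exists_pow (s ^ q * t)
    · exact ⟨1, σ, Or.inl rfl, by rw [hσ, one_mul]⟩
    · exact ⟨-1, σ, Or.inr rfl, by rw [hσ, neg_one_mul]⟩
  have hε2 : ε ^ 2 = 1 := by rcases hε with rfl | rfl <;> simp
  have hz : s ^ q * t ≠ 0 := mul_ne_zero (pow_ne_zero _ hs) ht
  have hσ0 : σ ≠ 0 := by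
    rintro rfl
    exact hz (by simpa using hσ)
  obtain ⟨τ, hτ⟩ : ∃ τ, σ * τ = b := ⟨b / σ, by field_simp⟩
  have hτ' : s * t ^ q = ε * τ ^ (q + 1) := by
    apply mul_left_cancel₀ hz
    have : σ ^ (q + 1) * τ ^ (q + 1) = s ^ (q + 1) * t ^ (q + 1) := by
      rw [← mul_pow, ← mul_pow, hst, hτ]
    calc s ^ q * t * (s * t ^ q) = s ^ (q + 1) * t ^ (q + 1) := by ring
      _ = ε ^ 2 * (σ ^ (q + 1) * τ ^ (q + 1)) := by rw [this, hε2, one_mul]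
      _ = s ^ q * t * (ε * τ ^ (q + 1)) := by rw [hσ]; ring
  have hne2 : σ ^ 2 ≠ τ ^ 2 := fun e' => hne (by rw [hσ, hτ', h.pow_eq_pow_iff.2 e'])
  rw [hσ, hτ'] at e
  have h2 := h.two_ne_zero
  refine ⟨ε * ((σ + τ) / 2) ^ (q + 1) - 1, h.mem_mixedFiber_iff.2
    ⟨ε, (σ + τ) / 2, (σ - τ) / 2, hε, ?_, ?_, by ring, ?_, ?_⟩⟩
  · intro e'
    apply hne2
    have : σ + τ = 0 := by simpa [h2] using e'
    linear_combination (σ - τ) * this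
  · intro e'
    apply hne2
    have : σ - τ = 0 := by simpa [h2] using e'
    linear_combination (σ + τ) * this
  · simp only [pow_succ, div_pow, h.add_pow, h.sub_pow, h.two_pow] at e ⊢
    field_simp
    linear_combination -2 * e
  · rw [← hτ]
    field_simp
    ring

lemma mixedFiber_zero_nonempty (h : IsTwistedSqrt q f) : (mixedFiber q f 0).Nonempty := by
  have h2 := h.two_ne_zero
  have e : (-(1 / 2) + 1 : F) = 1 / 2 := by field_simp; ring
  refine ⟨-(1 / 2), mem_mixedFiber.2 ⟨?_, ?_⟩⟩
  · rw [e, neg_neg]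
    rcases h.isUnitPow_or (x := 1 / 2) (by simp [h2]) with e | e
    · exact Or.inl ⟨e, e⟩
    · exact Or.inr ⟨e, e⟩
  · rw [e, h.apply_neg, sub_self]

end IsTwistedSqrt

/-! ### Sizes of the character classes. -/

namespace IsTwistedSqrt

variable {F : Type*} [Field F] {q : ℕ} {f : F → F}

lemma reflect_injective : Function.Injective (fun x : F => -1 - x) := sub_right_injective

lemma isUnitPow_one : IsUnitPow (q + 1) (1 : F) := ⟨1, one_ne_zero, (one_pow _).symm⟩

variable [Fintype F]

open Classical in
lemma two_mul_card_isUnitPow (h : IsTwistedSqrt q f) :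
    2 * #{x : F | IsUnitPow (q + 1) x} + 1 = Fintype.card F := by
  have : (univ : Finset F) = insert 0 (({x : F | IsUnitPow (q + 1) x} : Finset F) ∪
      ({x : F | IsUnitPow (q + 1) x} : Finset F).image Neg.neg) := by
    ext x
    simp only [mem_univ, mem_insert, mem_union, mem_filter, true_and, mem_image, true_iff]
    by_cases hx : x = 0
    · exact Or.inl hx
    · exact Or.inr ((h.isUnitPow_or hx).imp id fun e => ⟨-x, e, neg_neg x⟩)
  have hcard := congrArg Finset.card this
  rw [card_insert_of_notMem, card_union_of_disjoint,
    card_image_of_injective _ neg_injective, card_univ] at hcard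
  · rw [hcard]
    ring
  · rw [disjoint_left]
    simp only [mem_filter, mem_univ, true_and, mem_image, not_exists, not_and]
    rintro _ hx y hy rfl
    exact h.not_isUnitPow_neg hy hx
  · simp only [mem_union, mem_filter, mem_univ, true_and, mem_image, not_or, neg_eq_zero]
    exact ⟨fun e => isUnitPow_ne_zero e rfl,
      fun ⟨y, hy, hy0⟩ => isUnitPow_ne_zero hy hy0⟩

open Classical in
/-- The elements `x` such that `x` and `x + 1` are both `(q + 1)`-st powers of units. -/
noncomputable def sameSet (q : ℕ) (F : Type*) [Field F] [Fintype F] : Finset F :=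
  {x | IsUnitPow (q + 1) x ∧ IsUnitPow (q + 1) (x + 1)}

open Classical in
/-- The elements `x` such that `x` and `x + 1` are nonzero and of different quadratic character. -/
noncomputable def mixedSet (q : ℕ) (F : Type*) [Field F] [Fintype F] : Finset F :=
  {x | IsUnitPow (q + 1) (x + 1) ∧ IsUnitPow (q + 1) (-x) ∨
    IsUnitPow (q + 1) (-(x + 1)) ∧ IsUnitPow (q + 1) x}

lemma mem_sameSet {x : F} :
    x ∈ sameSet q F ↔ IsUnitPow (q + 1) x ∧ IsUnitPow (q + 1) (x + 1) := by
  simp [sameSet]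

lemma mem_mixedSet {x : F} :
    x ∈ mixedSet q F ↔ IsUnitPow (q + 1) (x + 1) ∧ IsUnitPow (q + 1) (-x) ∨
      IsUnitPow (q + 1) (-(x + 1)) ∧ IsUnitPow (q + 1) x := by
  simp [mixedSet]

open Classical in
/-- The classification of the elements of a finite set by the quadratic characters of `x` and
`x + 1`. -/
lemma card_filter_eq (h : IsTwistedSqrt q f) (P : F → Prop) :
    #{x | P x} = #{x ∈ sameSet q F | P x} + #{x ∈ sameSet q F | P (-1 - x)} +
      #{x ∈ mixedSet q F | P x} + #{x ∈ ({0, -1} : Finset F) | P x} := by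
  -- The reflection carries `sameSet` to the elements with `x` and `x + 1` both nonsquares.
  have h1 : #{x ∈ sameSet q F | P (-1 - x)} =
      #({x ∈ sameSet q F | P (-1 - x)}.image (fun x : F => -1 - x)) :=
    (card_image_of_injective _ reflect_injective).symm
  have himg : ∀ x : F, x ∈ ({x ∈ sameSet q F | P (-1 - x)}.image (fun x : F => -1 - x)) ↔
      (IsUnitPow (q + 1) (-x) ∧ IsUnitPow (q + 1) (-(x + 1))) ∧ P x := by
    intro x
    simp only [mem_image, mem_filter, mem_sameSet]
    constructor
    · rintro ⟨y, ⟨⟨hy1, hy2⟩, hy3⟩, rfl⟩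
      refine ⟨⟨?_, ?_⟩, hy3⟩
      · convert hy2 using 1; ring
      · convert hy1 using 1; ring
    · rintro ⟨⟨hx1, hx2⟩, hx3⟩
      refine ⟨-1 - x, ⟨⟨?_, ?_⟩, ?_⟩, by ring⟩
      · convert hx2 using 1; ring
      · convert hx1 using 1; ring
      · convert hx3 using 1; ring
  have hn : ∀ x : F, IsUnitPow (q + 1) x → ¬ IsUnitPow (q + 1) (-x) :=
    fun x => h.not_isUnitPow_neg
  have h0 : ¬ IsUnitPow (q + 1) (0 : F) := fun e => isUnitPow_ne_zero e rfl
  rw [h1, ← card_union_of_disjoint, ← card_union_of_disjoint, ← card_union_of_disjoint]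
  · congr 1
    ext x
    simp only [mem_union, himg]
    simp only [mem_filter, mem_univ, true_and, mem_sameSet, mem_mixedSet, mem_insert,
      mem_singleton]
    have hx : x = 0 ∨ IsUnitPow (q + 1) x ∨ IsUnitPow (q + 1) (-x) :=
      (eq_or_ne x 0).imp id h.isUnitPow_or
    have hx' : x = -1 ∨ IsUnitPow (q + 1) (x + 1) ∨ IsUnitPow (q + 1) (-(x + 1)) := by
      by_cases e : x = -1
      · exact Or.inl e
      · exact Or.inr (h.isUnitPow_or fun e' => e (eq_neg_of_add_eq_zero_left e'))
    tauto
  · rw [disjoint_left]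
    simp only [mem_union, himg]
    simp only [mem_filter, mem_sameSet, mem_mixedSet, mem_insert, mem_singleton]
    rintro x hx ⟨rfl | rfl, -⟩
    · simp [h0] at hx
    · simp [h0] at hx
  · rw [disjoint_left]
    simp only [mem_union, himg]
    simp only [mem_filter, mem_sameSet, mem_mixedSet]
    intro x
    have := hn x
    have := hn (x + 1)
    tauto
  · rw [disjoint_left]
    simp only [himg]
    simp only [mem_filter, mem_sameSet]
    intro x
    have := hn x
    tauto

/-- The map `x ↦ (x + 1) / x = 1 + 1 / x` is a bijection from `sameSet` and its reflection together
onto the nonzero squares other than `1`. -/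
lemma four_mul_card_sameSet (h : IsTwistedSqrt q f) :
    4 * #(sameSet q F) + 3 = Fintype.card F := by
  classical
  have h1 : #{y : F | IsUnitPow (q + 1) y ∧ y ≠ 1} + 1 = #{x : F | IsUnitPow (q + 1) x} := by
    have e : ({y : F | IsUnitPow (q + 1) y ∧ y ≠ 1} : Finset F) =
        ({x : F | IsUnitPow (q + 1) x} : Finset F).erase 1 := by
      ext x
      simp [and_comm]
    rw [e, card_erase_add_one]
    simpa using isUnitPow_one
  have hS : ∀ x : F, x ∈ sameSet q F ∪ (sameSet q F).image (fun x : F => -1 - x) ↔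
      x ≠ 0 ∧ IsUnitPow (q + 1) ((x + 1) / x) := by
    intro x
    simp only [mem_union, mem_image, mem_sameSet]
    constructor
    · rintro (⟨h1, h2⟩ | ⟨y, ⟨h1, h2⟩, rfl⟩)
      · exact ⟨isUnitPow_ne_zero h1, isUnitPow_div h2 h1⟩
      · have hy := isUnitPow_ne_zero h2
        refine ⟨fun e => hy (by linear_combination -e), ?_⟩
        convert isUnitPow_div h1 h2 using 1
        rw [← neg_div_neg_eq]
        congr 1 <;> ring
    · rintro ⟨hx, h1⟩
      rcases h.isUnitPow_or hx with h2 | h2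
      · refine Or.inl ⟨h2, ?_⟩
        convert isUnitPow_mul h1 h2 using 1
        field_simp
      · refine Or.inr ⟨-1 - x, ⟨?_, ?_⟩, by ring⟩
        · convert isUnitPow_mul h1 h2 using 1
          field_simp
          ring
        · convert h2 using 1
          ring
  have h2 : #(sameSet q F ∪ (sameSet q F).image (fun x : F => -1 - x)) =
      #{y : F | IsUnitPow (q + 1) y ∧ y ≠ 1} := by
    refine card_nbij' (fun x => (x + 1) / x) (fun y => 1 / (y - 1)) ?_ ?_ ?_ ?_
    · intro x hx
      rw [mem_coe, hS] at hx
      simp only [coe_filter, mem_univ, true_and, Set.mem_ofPred_eq]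
      refine ⟨hx.2, fun e => ?_⟩
      rw [div_eq_one_iff_eq hx.1] at e
      simp at e
    · intro y hy
      simp only [coe_filter, mem_univ, true_and, Set.mem_ofPred_eq] at hy
      have hy1 := sub_ne_zero.2 hy.2
      rw [mem_coe, hS]
      refine ⟨one_div_ne_zero hy1, ?_⟩
      convert hy.1 using 1
      field_simp
      ring
    · intro x hx
      rw [mem_coe, hS] at hx
      have hx0 := hx.1
      have : (x + 1) / x - 1 = 1 / x := by field_simp; ring
      simp only [this, one_div_one_div]
    · intro y hy
      simp only [coe_filter, mem_univ, true_and, Set.mem_ofPred_eq] at hy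
      have hy1 := sub_ne_zero.2 hy.2
      simp only
      field_simp
      ring
  rw [card_union_of_disjoint, card_image_of_injective _ reflect_injective] at h2
  · have := h.two_mul_card_isUnitPow
    omega
  · rw [disjoint_left]
    simp only [mem_image, mem_sameSet, not_exists, not_and]
    rintro _ ⟨hx, -⟩ y ⟨-, hy⟩ rfl
    refine h.not_isUnitPow_neg hx ?_
    convert hy using 1
    ring

end IsTwistedSqrt

/-! ### The value of `diffCount` at each `b`. -/

namespace IsTwistedSqrt

variable {F : Type*} [Field F] {q : ℕ} {f : F → F}

lemma one_ne_neg_one (h : IsTwistedSqrt q f) : (1 : F) ≠ -1 :=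
  fun e => h.two_ne_zero (by linear_combination e)

lemma apply_zero (h : IsTwistedSqrt q f) : f 0 = 0 := by simpa using h.apply_pow 0

lemma apply_one (h : IsTwistedSqrt q f) : f 1 = 1 := by simpa using h.apply_pow 1

variable [Fintype F]

lemma two_mul_card_mixedSet (h : IsTwistedSqrt q f) :
    2 * #(mixedSet q F) + 1 = Fintype.card F := by
  classical
  have h1 := h.card_filter_eq (fun _ => True)
  have h2 := h.four_mul_card_sameSet
  have h3 : #({0, -1} : Finset F) = 2 := card_pair (by simp)
  simp only [filter_true, card_univ, h3] at h1
  omega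

-- Reflection negates the derivative of `f`, whence the fibre over `-b`. The last term counts `x =
-- 0` and `x = -1`, where the derivative is `1` and `-1`.
open Classical in
lemma diffCount_eq (h : IsTwistedSqrt q f) (b : F) :
    diffCount f 1 b = #(sameFiber q f b) + #(sameFiber q f (-b)) + #(mixedFiber q f b) +
      if b = 1 ∨ b = -1 then 1 else 0 := by
  classical
  have h1 : diffCount f 1 b = #{x | f (x + 1) - f x = b} := by
    rw [diffCount, Set.ncard_eq_toFinset_card']
    congr 1
    ext
    simp
  rw [h1, h.card_filter_eq]
  congr 1
  · congr 1
    · congr 1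
      · congr 1
        ext x
        simp [mem_sameFiber, mem_sameSet, and_assoc]
      · congr 1
        ext x
        have e1 : f (-1 - x + 1) = f x := by rw [← h.apply_neg x]; congr 1; ring
        have e2 : f (-1 - x) = f (x + 1) := by rw [← h.apply_neg (x + 1)]; congr 1; ring
        simp only [mem_sameFiber, mem_sameSet, mem_filter, and_assoc, e1, e2]
        rw [← neg_sub, neg_eq_iff_eq_neg]
    · congr 1
      ext x
      simp [mem_mixedFiber, mem_mixedSet]
  · have e : f (-1) = 1 := by rw [h.apply_neg, h.apply_one]
    rw [filter_insert, filter_singleton]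
    simp only [zero_add, h.apply_one, h.apply_zero, neg_add_cancel, e, sub_zero, zero_sub]
    have := h.one_ne_neg_one
    by_cases hb1 : b = 1
    · subst hb1
      simp [this.symm]
    · by_cases hb2 : b = -1
      · subst hb2
        simp [this]
      · simp [hb1, hb2, Ne.symm hb1, Ne.symm hb2]

/-- The count is `(q - 3) / 4` from `pairs q 1`, plus one from `x = 0` or `x = -1`. -/
lemma diffCount_one (h : IsTwistedSqrt q f) {b : F} (hb : b = 1 ∨ b = -1) :
    diffCount f 1 b = (q + 1) / 4 := by
  classical
  have h1 := h.four_mul_card_sameFiber 1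
  have h2 := h.four_mul_card_sameFiber (-1)
  rw [h.card_pairs_one] at h1
  rw [h.pairs_neg_one, card_empty] at h2
  have h3 := h.mod_four
  rw [h.diffCount_eq, if_pos hb, h.mixedFiber_eq_empty hb, card_empty]
  rcases hb with rfl | rfl
  · omega
  · rw [neg_neg]
    omega

lemma card_mixedFiber_le_one (h : IsTwistedSqrt q f) (b : F) : #(mixedFiber q f b) ≤ 1 :=
  card_le_one.2 fun _ hx _ hy => h.mixedFiber_subsingleton hx hy

open Classical in
/-- The elements `b ≠ ±1` for which `sameFiber q f b` is nonempty. -/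
noncomputable def sameValues (q : ℕ) (F : Type*) [Field F] [Fintype F] : Finset F :=
  {b | b ≠ 1 ∧ b ≠ -1 ∧ (pairs q b).Nonempty}

open Classical in
/-- The elements `b` with `b` or `-b` in `sameValues q F`. -/
noncomputable def largeValues (q : ℕ) (F : Type*) [Field F] [Fintype F] : Finset F :=
  sameValues q F ∪ (sameValues q F).image Neg.neg

open Classical in
/-- The values of the derivative of `f` on `mixedSet q F`. -/
noncomputable def mixedValues (q : ℕ) (f : F → F) : Finset F :=
  (mixedSet q F).image (fun x => f (x + 1) - f x)

lemma mem_sameValues {b : F} :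
    b ∈ sameValues q F ↔ b ≠ 1 ∧ b ≠ -1 ∧ (pairs q b).Nonempty := by
  simp [sameValues]

lemma mem_largeValues {b : F} : b ∈ largeValues q F ↔
    b ≠ 1 ∧ b ≠ -1 ∧ ((pairs q b).Nonempty ∨ (pairs q (-b)).Nonempty) := by
  classical
  have : b ∈ (sameValues q F).image Neg.neg ↔ -b ∈ sameValues q F := by
    simp only [mem_image]
    exact ⟨by rintro ⟨c, hc, rfl⟩; rwa [neg_neg], fun e => ⟨_, e, neg_neg b⟩⟩
  rw [largeValues, mem_union, this, mem_sameValues, mem_sameValues, ne_eq (-b), ne_eq (-b),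
    neg_eq_iff_eq_neg, neg_inj]
  tauto

lemma mem_mixedValues {b : F} : b ∈ mixedValues q f ↔ (mixedFiber q f b).Nonempty := by
  simp only [mixedValues, mem_image, mem_mixedSet]
  exact exists_congr fun x => mem_mixedFiber.symm

lemma two_mul_card_mixedValues (h : IsTwistedSqrt q f) :
    2 * #(mixedValues q f) + 1 = Fintype.card F := by
  classical
  rw [← h.two_mul_card_mixedSet, mixedValues, card_image_of_injOn]
  intro x hx y hy e
  rw [mem_coe, mem_mixedSet] at hx hy
  exact h.mixedFiber_subsingleton (mem_mixedFiber.2 ⟨hx, e⟩) (mem_mixedFiber.2 ⟨hy, rfl⟩)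

lemma largeValues_subset (h : IsTwistedSqrt q f) : largeValues q F ⊆ mixedValues q f := by
  intro b hb
  rw [mem_largeValues] at hb
  rw [mem_mixedValues]
  obtain ⟨h1, h2, h3 | h3⟩ := hb
  · exact h.mixedFiber_nonempty_of_pairs h1 h2 h3
  · obtain ⟨x, hx⟩ := h.mixedFiber_nonempty_of_pairs
      (fun e => h2 (by rw [← e, neg_neg])) (fun e => h1 (neg_inj.1 e)) h3
    rw [mem_mixedFiber] at hx
    have e1 : f (-1 - x + 1) = f x := by rw [← h.apply_neg x]; congr 1; ring
    have e2 : f (-1 - x) = f (x + 1) := by rw [← h.apply_neg (x + 1)]; congr 1; ring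
    have e3 : -1 - x + 1 = -x := by ring
    have e4 : -(-1 - x) = x + 1 := by ring
    have e5 : -(-1 - x + 1) = x := by ring
    have e6 : -1 - x = -(x + 1) := by ring
    -- Reflection preserves `mixedSet` and negates the derivative.
    refine ⟨-1 - x, mem_mixedFiber.2 ⟨?_, ?_⟩⟩
    · rw [e5, e4, e3, e6]
      tauto
    · rw [e1, e2]
      linear_combination -hx.2

lemma one_notMem_mixedValues (h : IsTwistedSqrt q f) {b : F} (hb : b = 1 ∨ b = -1) :
    b ∉ mixedValues q f := by
  rw [mem_mixedValues, h.mixedFiber_eq_empty hb]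
  simp

lemma zero_mem_mixedValues (h : IsTwistedSqrt q f) : (0 : F) ∈ mixedValues q f :=
  mem_mixedValues.2 h.mixedFiber_zero_nonempty

lemma zero_notMem_largeValues (h : IsTwistedSqrt q f) : (0 : F) ∉ largeValues q F := by
  rw [mem_largeValues, neg_zero, or_self]
  rintro ⟨-, -, p, hp⟩
  exact h.ne_zero_of_mem_pairs hp rfl

/-- Sum `#(pairs q b)` over `b`: the total `4 * #(sameSet q F) = Q - 3` consists of `q - 3` from `b
= 1` and `2 * (q - 1)` from each element of `sameValues`. That set is disjoint from its negative,
which doubles the count. -/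
lemma card_largeValues (h : IsTwistedSqrt q f) :
    #(largeValues q F) * (q - 1) + q = Fintype.card F := by
  classical
  have h1 : #(largeValues q F) = 2 * #(sameValues q F) := by
    rw [largeValues, card_union_of_disjoint, card_image_of_injective _ neg_injective, two_mul]
    rw [disjoint_left]
    simp only [mem_image, not_exists, not_and]
    rintro _ hx y hy rfl
    rw [mem_sameValues] at hx hy
    rw [h.pairs_neg_eq_empty hy.2.2] at hx
    exact not_nonempty_empty hx.2.2
  have h2 : #(sameSet q F) = ∑ b : F, #(sameFiber q f b) := by
    rw [card_eq_sum_card_fiberwise (f := fun x => f (x + 1) - f x) (t := univ) (by simp)]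
    refine sum_congr rfl fun b _ => ?_
    congr 1
    ext x
    simp [mem_sameFiber, mem_sameSet, and_assoc]
  have h3 : 4 * #(sameSet q F) = ∑ b : F, #(pairs q b) := by
    rw [h2, mul_sum]
    exact sum_congr rfl fun b _ => h.four_mul_card_sameFiber b
  have h4 : ∑ b : F, #(pairs q b) = ∑ b ∈ insert 1 (sameValues q F), #(pairs q b) := by
    symm
    apply sum_subset (subset_univ _)
    intro b _ hb
    rw [mem_insert, mem_sameValues, not_or] at hb
    rw [card_eq_zero]
    by_cases hb2 : b = -1
    · rw [hb2, h.pairs_neg_one]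
    · by_contra hne
      exact hb.2 ⟨hb.1, hb2, nonempty_iff_ne_empty.2 hne⟩
  rw [sum_insert (by simp [mem_sameValues]), h.card_pairs_one,
    sum_const_nat (s := sameValues q F) (m := 2 * (q - 1))] at h4
  · have h5 := h.four_mul_card_sameSet
    rw [h3, h4] at h5
    have h6 := h.mod_four
    have h7 : 2 * #(sameValues q F) * (q - 1) = #(sameValues q F) * (2 * (q - 1)) := by ring
    rw [h1, ← h5, h7]
    omega
  · intro b hb
    rw [mem_sameValues] at hb
    exact h.card_pairs hb.1 hb.2.1 hb.2.2

/-- Exactly one of `b`, `-b` contributes `(q - 1) / 2`, and the mixed fibre adds one. -/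
lemma diffCount_of_mem_largeValues (h : IsTwistedSqrt q f) {b : F} (hb : b ∈ largeValues q F) :
    diffCount f 1 b = (q + 1) / 2 := by
  classical
  have h1 := h.four_mul_card_sameFiber b
  have h2 := h.four_mul_card_sameFiber (-b)
  have h3 := card_pos.2 (mem_mixedValues.1 (h.largeValues_subset hb))
  have h4 := h.card_mixedFiber_le_one b
  have h5 := h.mod_four
  rw [mem_largeValues] at hb
  obtain ⟨hb1, hb2, hb3 | hb3⟩ := hb
  · rw [h.card_pairs hb1 hb2 hb3] at h1
    rw [h.pairs_neg_eq_empty hb3, card_empty] at h2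
    rw [h.diffCount_eq, if_neg (by tauto)]
    omega
  · rw [h.card_pairs (fun e => hb2 (by rw [← e, neg_neg])) (fun e => hb1 (neg_inj.1 e)) hb3] at h2
    have h6 := h.pairs_neg_eq_empty hb3
    rw [neg_neg] at h6
    rw [h6, card_empty] at h1
    rw [h.diffCount_eq, if_neg (by tauto)]
    omega

lemma diffCount_of_notMem_largeValues (h : IsTwistedSqrt q f) {b : F} (hb1 : b ≠ 1)
    (hb2 : b ≠ -1) (hb : b ∉ largeValues q F) : diffCount f 1 b = #(mixedFiber q f b) := by
  classical
  have h1 := h.four_mul_card_sameFiber b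
  have h2 := h.four_mul_card_sameFiber (-b)
  rw [mem_largeValues] at hb
  simp only [hb1, hb2, ne_eq, not_false_eq_true, true_and, not_or,
    not_nonempty_iff_eq_empty] at hb
  rw [hb.1, card_empty] at h1
  rw [hb.2, card_empty] at h2
  rw [h.diffCount_eq, if_neg (by tauto)]
  omega

open Classical in
theorem diffCount_eq_ite (h : IsTwistedSqrt q f) (b : F) :
    diffCount f 1 b = if b = 1 ∨ b = -1 then (q + 1) / 4
      else if b ∈ largeValues q F then (q + 1) / 2
      else if b ∈ mixedValues q f then 1 else 0 := by
  split_ifs with h1 h2 h3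
  · exact h.diffCount_one h1
  · exact h.diffCount_of_mem_largeValues h2
  · rw [not_or] at h1
    rw [h.diffCount_of_notMem_largeValues h1.1 h1.2 h2]
    exact le_antisymm (h.card_mixedFiber_le_one b) (card_pos.2 (mem_mixedValues.1 h3))
  · rw [not_or] at h1
    rw [h.diffCount_of_notMem_largeValues h1.1 h1.2 h2, card_eq_zero,
      ← not_nonempty_iff_eq_empty, ← mem_mixedValues]
    exact h3

end IsTwistedSqrt

/-! ### From pointwise counts to the spectrum. -/

namespace IsTwistedSqrt

variable {F : Type*} [Field F] {q : ℕ} {f : F → F}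

lemma diffSpectrum_eq_card {i : ℕ} {s : Finset F}
    (hs : ∀ b, diffCount f 1 b = i ↔ b ∈ s) : diffSpectrum f i = #s := by
  rw [diffSpectrum, ← Set.ncard_coe_finset]
  congr 1
  ext b
  exact hs b

variable [Fintype F]

lemma cast_card_largeValues (h : IsTwistedSqrt q f) :
    (#(largeValues q F) : ℚ) = ((Fintype.card F : ℚ) - q) / (q - 1) := by
  have h4 := h.mod_four
  have h1 : (1 : ℚ) < q := by exact_mod_cast (show 1 < q by omega)
  have h2 := congrArg (Nat.cast (R := ℚ)) h.card_largeValues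
  rw [Nat.cast_add, Nat.cast_mul, Nat.cast_sub (by omega), Nat.cast_one] at h2
  rw [eq_div_iff (by linarith)]
  linarith

lemma cast_card_mixedValues (h : IsTwistedSqrt q f) :
    (#(mixedValues q f) : ℚ) = ((Fintype.card F : ℚ) - 1) / 2 := by
  have h2 := congrArg (Nat.cast (R := ℚ)) h.two_mul_card_mixedValues
  push_cast at h2
  linarith

open Classical in
lemma cast_card_compl (h : IsTwistedSqrt q f) :
    (#(insert 1 (insert (-1) (mixedValues q f)))ᶜ : ℚ) = ((Fintype.card F : ℚ) - 3) / 2 := by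
  have h1 := h.two_mul_card_mixedValues
  have h2 : #(insert 1 (insert (-1) (mixedValues q f))) = #(mixedValues q f) + 2 := by
    rw [card_insert_of_notMem, card_insert_of_notMem (h.one_notMem_mixedValues (Or.inr rfl))]
    rw [mem_insert, not_or]
    exact ⟨h.one_ne_neg_one, h.one_notMem_mixedValues (Or.inl rfl)⟩
  have h3 := card_add_card_compl (insert 1 (insert (-1) (mixedValues q f)))
  rw [h2] at h3
  have h4 : 2 * #(insert 1 (insert (-1) (mixedValues q f)))ᶜ + 3 = Fintype.card F := by omega
  have h5 := congrArg (Nat.cast (R := ℚ)) h4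
  push_cast at h5 ⊢
  linarith

lemma setOf_diffCount_eq (h : IsTwistedSqrt q f) (hq : q ≠ 3) :
    {b : F | diffCount f 1 b = (q + 1) / 4} = {1, -1} := by
  have h4 := h.mod_four
  ext b
  rw [Set.mem_ofPred_eq, h.diffCount_eq_ite, Set.mem_insert_iff, Set.mem_singleton_iff]
  -- Here `q ≥ 7`, so `(q + 1) / 4 ≥ 2` differs from `(q + 1) / 2`, `1` and `0`.
  split_ifs with h1 <;> simp only [h1, iff_false] <;> omega

theorem diffSpectrum_eq (h : IsTwistedSqrt q f) (hq : q ≠ 3) (i : ℕ) :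
    (diffSpectrum f i : ℚ) =
      if i = (q + 1) / 4 then 2
      else if i = (q + 1) / 2 then ((Fintype.card F : ℚ) - q) / (q - 1)
      else if i = 1 then
        ((Fintype.card F : ℚ) - 1) / 2 - ((Fintype.card F : ℚ) - q) / (q - 1)
      else if i = 0 then ((Fintype.card F : ℚ) - 3) / 2
      else 0 := by
  classical
  have h4 := h.mod_four
  have hLM : ∀ b, b ∈ largeValues q F → b ∈ mixedValues q f := fun b hb => h.largeValues_subset hb
  have hM : ∀ b, b = 1 ∨ b = -1 → b ∉ mixedValues q f := fun b => h.one_notMem_mixedValues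
  split_ifs with h1 h2 h3 h5
  · rw [diffSpectrum, h1, h.setOf_diffCount_eq hq, Set.ncard_pair h.one_ne_neg_one]
    rfl
  · rw [← h.cast_card_largeValues]
    congr 1
    apply diffSpectrum_eq_card
    intro b
    have := hLM b
    have := hM b
    rw [h.diffCount_eq_ite]
    split_ifs with c1 c2 c3 <;> constructor <;> intro hh <;> first | omega | tauto
  · rw [← h.cast_card_largeValues, ← h.cast_card_mixedValues,
      ← Nat.cast_sub (card_le_card h.largeValues_subset),
      ← card_sdiff_of_subset h.largeValues_subset]
    congr 1
    apply diffSpectrum_eq_card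
    intro b
    have := hLM b
    have := hM b
    rw [h.diffCount_eq_ite, mem_sdiff]
    split_ifs with c1 c2 c3 <;> constructor <;> intro hh <;> first | omega | tauto
  · rw [← h.cast_card_compl]
    congr 1
    apply diffSpectrum_eq_card
    intro b
    have := hLM b
    have := hM b
    rw [h.diffCount_eq_ite, mem_compl, mem_insert, mem_insert]
    split_ifs with c1 c2 c3 <;> constructor <;> intro hh <;> first | omega | tauto
  · rw [diffSpectrum_eq_card (s := ∅)]
    · simp
    intro b
    rw [h.diffCount_eq_ite]
    split_ifs with c1 c2 c3 <;> constructor <;> intro hh <;> first | omega | simp at hh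

/-- For `q = 3` the sizes are `(Q - 1) / 2` and `(Q - 3) / 2`, so the single remaining value must be
`0`, attained at `x = -1 / 2`. -/
lemma mixedValues_sdiff_largeValues [DecidableEq F] (h : IsTwistedSqrt 3 f) :
    mixedValues 3 f \ largeValues 3 F = {0} := by
  have h1 := h.two_mul_card_mixedValues
  have h2 := h.card_largeValues
  have h3 := card_sdiff_of_subset h.largeValues_subset
  have h4 : #(mixedValues 3 f \ largeValues 3 F) = 1 := by omega
  obtain ⟨a, ha⟩ := card_eq_one.1 h4
  have h0 : (0 : F) ∈ mixedValues 3 f \ largeValues 3 F :=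
    mem_sdiff.2 ⟨h.zero_mem_mixedValues, h.zero_notMem_largeValues⟩
  rw [ha, mem_singleton] at h0
  rw [ha, h0]

lemma setOf_diffCount_eq_of_three (h : IsTwistedSqrt 3 f) :
    {b : F | diffCount f 1 b = 1} = {0, 1, -1} := by
  classical
  ext b
  have hb := congrArg (b ∈ ·) h.mixedValues_sdiff_largeValues
  have hM : b = 1 ∨ b = -1 → b ∉ mixedValues 3 f := h.one_notMem_mixedValues
  simp only [mem_sdiff, mem_singleton, eq_iff_iff] at hb
  rw [Set.mem_ofPred_eq, h.diffCount_eq_ite, Set.mem_insert_iff, Set.mem_insert_iff,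
    Set.mem_singleton_iff, ← hb]
  split_ifs with c1 c2 c3 <;> constructor <;> intro hh <;> first | omega | tauto

theorem diffSpectrum_eq_of_three (h : IsTwistedSqrt 3 f) (i : ℕ) :
    (diffSpectrum f i : ℚ) =
      if i = 2 then ((Fintype.card F : ℚ) - 3) / 2
      else if i = 1 then 3
      else if i = 0 then ((Fintype.card F : ℚ) - 3) / 2
      else 0 := by
  classical
  have hLM : ∀ b, b ∈ largeValues 3 F → b ∈ mixedValues 3 f := fun b hb => h.largeValues_subset hb
  have hM : ∀ b, b = 1 ∨ b = -1 → b ∉ mixedValues 3 f := fun b => h.one_notMem_mixedValues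
  split_ifs with h1 h2 h3
  · have hL := h.cast_card_largeValues
    norm_num at hL
    rw [← hL]
    congr 1
    apply diffSpectrum_eq_card
    intro b
    have := hLM b
    have := hM b
    rw [h.diffCount_eq_ite]
    split_ifs with c1 c2 c3 <;> constructor <;> intro hh <;> first | omega | tauto
  · have h01 : (0 : F) ∉ ({1, -1} : Set F) := by simp
    rw [diffSpectrum, h2, h.setOf_diffCount_eq_of_three, Set.ncard_insert_of_notMem h01,
      Set.ncard_pair h.one_ne_neg_one]
    norm_num
  · rw [← h.cast_card_compl]
    congr 1
    apply diffSpectrum_eq_card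
    intro b
    have := hLM b
    have := hM b
    rw [h.diffCount_eq_ite, mem_compl, mem_insert, mem_insert]
    split_ifs with c1 c2 c3 <;> constructor <;> intro hh <;> first | omega | tauto
  · rw [diffSpectrum_eq_card (s := ∅)]
    · simp
    intro b
    rw [h.diffCount_eq_ite]
    split_ifs with c1 c2 c3 <;> constructor <;> intro hh <;> first | omega | simp at hh

end IsTwistedSqrt

theorem mainTheorem3 {F : Type*} [Field F] [Finite F] (p n k d : ℕ)
    (hp : p.Prime) (hp4 : p % 4 = 3) (hn : Odd n) (hk : k ∣ n)
    (hF : Nat.card F = p ^ n)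
    (hd : d = (p ^ n + 1) / (p ^ k + 1) + (p ^ n - 1) / 2) :
    (p ^ k ≠ 3 →
      (∀ i : ℕ, (diffSpectrum (fun x : F => x ^ d) i : ℚ) =
        if i = (p ^ k + 1) / 4 then 2
        else if i = (p ^ k + 1) / 2 then ((p : ℚ) ^ n - (p : ℚ) ^ k) / ((p : ℚ) ^ k - 1)
        else if i = 1 then
          ((p : ℚ) ^ n - 1) / 2 - ((p : ℚ) ^ n - (p : ℚ) ^ k) / ((p : ℚ) ^ k - 1)
        else if i = 0 then ((p : ℚ) ^ n - 3) / 2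
        else 0) ∧
      {b : F | diffCount (fun x : F => x ^ d) 1 b = (p ^ k + 1) / 4} = {1, -1}) ∧
    (p ^ k = 3 →
      (∀ i : ℕ, (diffSpectrum (fun x : F => x ^ d) i : ℚ) =
        if i = 2 then ((p : ℚ) ^ n - 3) / 2
        else if i = 1 then 3
        else if i = 0 then ((p : ℚ) ^ n - 3) / 2
        else 0) ∧
      {b : F | diffCount (fun x : F => x ^ d) 1 b = 1} = {0, 1, -1}) := by
  have := Fintype.ofFinite F
  have h := isTwistedSqrt_pow (F := F) hp hp4 hn hk hF hd
  have hQ : (Fintype.card F : ℚ) = (p : ℚ) ^ n := by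
    rw [← Nat.card_eq_fintype_card, hF, Nat.cast_pow]
  refine ⟨fun hq => ⟨fun i => ?_, h.setOf_diffCount_eq hq⟩, fun hq => ?_⟩
  · have h1 := h.diffSpectrum_eq hq i
    rwa [hQ, Nat.cast_pow] at h1
  · rw [hq] at h
    refine ⟨fun i => ?_, h.setOf_diffCount_eq_of_three⟩
    have h1 := h.diffSpectrum_eq_of_three i
    rwa [hQ] at h1
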